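/- Let $1 \to C \to A \to Q \to 1$ be a short exact sequence of finitely generated groups, and let $d_C$ be the word metric on $C$ corresponding to a choice of finite generating set for $C$. Suppose that $A$ is word hyperbolic and that $Q$ contains an undistorted cyclic subgroup $\langle x \rangle$, i.e. for the word metric $d_Q$ of a finite generating set of $Q$ there is a constant $\lambda > 0$ such that $d_Q(x^n, x^m) \ge \lambda |n - m|$ for all integers $n$ and $m$. Let $a \in A$ be an element of the preimage of $x$. Then for every element $c \in C$ of infinite order there exist constants $\alpha > 1$ and $\beta > 0$ such that $d_C(1, a^{-n} c a^n) > \alpha^n - \beta$ for every $n \in \mathbb{N}$. -/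

import Mathlib

namespace WordMetric

/-- The word metric `d_S(g, h)`: the distance from `g` to `h` in the Cayley graph of `G` with respect
to `S`, in which `g` and `g s`, `s ∈ S`, are joined by an edge. Equivalently, the least length of a
word in the letters `s` and `s⁻¹`, `s ∈ S`, that represents `g⁻¹ h`. (It is used only for generating
sets `S`, for which the Cayley graph is connected.) -/
noncomputable def wordDist {G : Type*} [Group G] (S : Finset G) (g h : G) : ℕ :=
  (SimpleGraph.mulCayley (S : Set G)).dist g h

/-- The Gromov product `(x | y)_w` for the word metric of `S`. -/
noncomputable def gromovProduct {G : Type*} [Group G] (S : Finset G) (w x y : G) : ℝ :=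
  ((wordDist S x w : ℝ) + (wordDist S y w : ℝ) - (wordDist S x y : ℝ)) / 2

/-- `G` is word hyperbolic (Gromov): for some finite generating set, `G` with its word metric is a
`δ`-hyperbolic metric space for some `δ`, that is, `(x | z)_w ≥ min ((x | y)_w, (y | z)_w) - δ`
for all points. In particular `G` is finitely generated. -/
def IsWordHyperbolic (G : Type*) [Group G] : Prop :=
  ∃ S : Finset G, Subgroup.closure (S : Set G) = ⊤ ∧
    ∃ δ : ℝ, ∀ w x y z : G,
      min (gromovProduct S w x y) (gromovProduct S w y z) - δ ≤ gromovProduct S w x z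

/-- `G` is finitely generated and the cyclic subgroup generated by `x` is undistorted:
for the word metric `d` of a finite generating set and some `r > 0`,
`d(xⁿ, xᵐ) ≥ r |n - m|` for all integers `n`, `m`. -/
def IsUndistorted {G : Type*} [Group G] (x : G) : Prop :=
  ∃ T : Finset G, Subgroup.closure (T : Set G) = ⊤ ∧
    ∃ r : ℝ, 0 < r ∧ ∀ n m : ℤ, r * |(n : ℝ) - (m : ℝ)| ≤ (wordDist T (x ^ n) (x ^ m) : ℝ)

end WordMetric

namespace WordMetric

/-! ### Word metrics and Lipschitz maps -/

section WordDist

variable {G H : Type*} [Group G] [Group H]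

/-! Take a geodesic of `C` from 1 to `a⁻ⁿ c aⁿ` and translate it by `aⁿ` in `A`. It becomes a path
from `aⁿ` to `c aⁿ` with steps of bounded length, lying over `xⁿ`; as `x` is undistorted, all its
points have length at least a constant times `n`. Hence consecutive points have Gromov product
linear in `n`. By repeated bisection (`le_lengthProduct_two_pow`) the endpoints' product is smaller
only by a term logarithmic in the length of the path. If that product is bounded in `n`, the path
must be exponentially long.

The bound is `exists_lengthProduct_pow_le_of_undistorted`. A power `b` of `a` has quasi-geodesic
powers with an additive error. If the products `(bⁿ | c bⁿ)` were unbounded, the conjugates `b⁻ⁱ c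
bⁱ` would stay in a finite ball, so `c` would commute with a power of `b`; then a power of `c` would
be a power of `b`. In `Q` this forces the exponent of `a` to vanish, so `c` would have finite order.
-/

lemma mulCayley_connected {S : Finset G} (hS : Subgroup.closure (S : Set G) = ⊤) :
    (SimpleGraph.mulCayley (S : Set G)).Connected := by
  have key : ∀ g ∈ Subgroup.closure (S : Set G), ∀ u : G,
      (SimpleGraph.mulCayley (S : Set G)).Reachable u (u * g) := by
    intro g hg
    induction hg using Subgroup.closure_induction with
    | mem s hs =>
      intro u
      by_cases h : u = u * s
      · rw [← h]
      · exact SimpleGraph.Adj.reachable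
          ((SimpleGraph.mulCayley_adj _ _ _).2 ⟨h, Or.inl (by simpa using hs)⟩)
    | one => intro u; rw [mul_one]
    | mul g h _ _ ihg ihh => intro u; rw [← mul_assoc]; exact (ihg u).trans (ihh _)
    | inv g _ ih =>
      intro u
      have := (ih (u * g⁻¹)).symm
      rwa [inv_mul_cancel_right] at this
  have : Nonempty G := ⟨1⟩
  refine SimpleGraph.Connected.mk fun u v => ?_
  have := key (u⁻¹ * v) (by rw [hS]; exact Subgroup.mem_top _) u
  rwa [mul_inv_cancel_left] at this

/-- Only edges need checking, so this covers left translations as well as homomorphisms. -/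
lemma wordDist_map_le {S : Finset G} (hS : Subgroup.closure (S : Set G) = ⊤) {T : Finset H}
    (hT : Subgroup.closure (T : Set H) = ⊤) {φ : G → H} {L : ℕ}
    (hφ : ∀ g h, (SimpleGraph.mulCayley (S : Set G)).Adj g h → wordDist T (φ g) (φ h) ≤ L)
    (g h : G) : wordDist T (φ g) (φ h) ≤ L * wordDist S g h := by
  obtain ⟨p, hp⟩ := (mulCayley_connected hS).exists_walk_length_eq_dist g h
  rw [wordDist, wordDist, ← hp]
  clear hp
  induction p with
  | nil => simp
  | @cons u v w hadj p ih =>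
    refine ((mulCayley_connected hT).dist_triangle (v := φ v)).trans ?_
    have := hφ _ _ hadj
    rw [wordDist] at this
    rw [SimpleGraph.Walk.length_cons, mul_add, mul_one, add_comm]
    exact add_le_add ih this

lemma wordDist_comm (S : Finset G) (g h : G) : wordDist S g h = wordDist S h g :=
  SimpleGraph.dist_comm

lemma wordDist_mul_left {S : Finset G} (hS : Subgroup.closure (S : Set G) = ⊤) (u g h : G) :
    wordDist S (u * g) (u * h) = wordDist S g h := by
  have key : ∀ v g h : G, wordDist S (v * g) (v * h) ≤ wordDist S g h := by
    intro v g h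
    have := wordDist_map_le hS hS (φ := fun g => v * g) (L := 1) (fun g h hgh => by
      rw [wordDist, SimpleGraph.dist_eq_one_iff_adj.2 (SimpleGraph.mulCayley_adj_mul_iff_right.2 hgh)])
      g h
    simpa using this
  refine le_antisymm (key u g h) ?_
  simpa using key u⁻¹ (u * g) (u * h)

lemma wordDist_one_inv_mul {S : Finset G} (hS : Subgroup.closure (S : Set G) = ⊤) (g h : G) :
    wordDist S 1 (g⁻¹ * h) = wordDist S g h := by
  rw [← wordDist_mul_left hS g, mul_one, mul_inv_cancel_left]

/-- Group homomorphisms are Lipschitz for word metrics. -/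
lemma exists_wordDist_map_le {S : Finset G} (hS : Subgroup.closure (S : Set G) = ⊤) {T : Finset H}
    (hT : Subgroup.closure (T : Set H) = ⊤) (φ : G →* H) :
    ∃ L : ℕ, ∀ g h, wordDist T (φ g) (φ h) ≤ L * wordDist S g h := by
  refine ⟨S.sup fun s => wordDist T 1 (φ s), wordDist_map_le hS hT fun g h hgh => ?_⟩
  have le_sup : ∀ s ∈ S, wordDist T 1 (φ s) ≤ S.sup fun s => wordDist T 1 (φ s) :=
    fun s hs => Finset.le_sup (f := fun s => wordDist T 1 (φ s)) hs
  rcases ((SimpleGraph.mulCayley_adj _ _ _).1 hgh).2 with h' | h'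
  · rw [← wordDist_one_inv_mul hT, ← map_inv, ← map_mul]
    exact le_sup _ h'
  · rw [wordDist_comm, ← wordDist_one_inv_mul hT, ← map_inv, ← map_mul]
    exact le_sup _ h'

lemma finite_setOf_wordDist_le {S : Finset G} (hS : Subgroup.closure (S : Set G) = ⊤) (n : ℕ) :
    {g : G | wordDist S 1 g ≤ n}.Finite := by
  classical
  induction n with
  | zero =>
    refine (Set.finite_singleton (1 : G)).subset fun g hg => ?_
    have : wordDist S 1 g = 0 := Nat.le_zero.1 hg
    exact ((mulCayley_connected hS).dist_eq_zero_iff.1 this).symm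
  | succ n ih =>
    have hfin : (Set.image2 (fun s g : G => s * g) (S ∪ (S : Set G)⁻¹) {g : G | wordDist S 1 g ≤ n}
        ∪ {1}).Finite :=
      (Set.Finite.image2 _ (S.finite_toSet.union S.finite_toSet.inv) ih).union
        (Set.finite_singleton 1)
    refine hfin.subset fun g hg => ?_
    obtain ⟨p, hp⟩ := (mulCayley_connected hS).exists_walk_length_eq_dist 1 g
    change wordDist S 1 g ≤ n + 1 at hg
    rw [wordDist, ← hp] at hg
    cases p with
    | nil => right; rfl
    | cons hadj p =>
      rename_i s
      left
      refine ⟨s, ?_, s⁻¹ * g, ?_, by simp⟩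
      · have := ((SimpleGraph.mulCayley_adj _ _ _).1 hadj).2
        simpa using this
      · change wordDist S 1 (s⁻¹ * g) ≤ n
        rw [wordDist_one_inv_mul hS]
        rw [SimpleGraph.Walk.length_cons] at hg
        exact (SimpleGraph.dist_le p).trans (by omega)

end WordDist

/-- A discrete intermediate value theorem. -/
lemma exists_abs_le_of_step {φ : ℕ → ℝ} {B : ℝ} (hB : 0 ≤ B) {n : ℕ} (h0 : 0 ≤ φ 0)
    (hn : φ n ≤ 0) (hstep : ∀ i < n, φ i - φ (i + 1) ≤ B) : ∃ i ≤ n, |φ i| ≤ B := by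
  induction n with
  | zero => exact ⟨0, le_rfl, by rw [le_antisymm hn h0, abs_zero]; exact hB⟩
  | succ n ih =>
    rcases le_total (φ n) 0 with h | h
    · obtain ⟨i, hi, hi'⟩ := ih h fun i hi => hstep i (by omega)
      exact ⟨i, by omega, hi'⟩
    · refine ⟨n + 1, le_rfl, ?_⟩
      rw [abs_of_nonpos hn]
      linarith [hstep n (by omega)]

/-! ### Hyperbolic length functions -/

/-- Twice the Gromov product at `1` of two elements, for the left-invariant distance
`d(x, y) = ℓ (x⁻¹ y)`. -/
def lengthProduct {G : Type*} [Group G] (ℓ : G → ℝ) (x y : G) : ℝ :=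
  ℓ x + ℓ y - ℓ (x⁻¹ * y)

/-- A length function on a group whose associated left-invariant distance is Gromov
hyperbolic. -/
structure IsHyperbolicLength {G : Type*} [Group G] (ℓ : G → ℝ) (δ : ℝ) : Prop where
  map_one : ℓ 1 = 0
  map_inv : ∀ g, ℓ g⁻¹ = ℓ g
  map_mul_le : ∀ g h, ℓ (g * h) ≤ ℓ g + ℓ h
  delta_pos : 0 < δ
  product_ge : ∀ x y z,
    min (lengthProduct ℓ x y) (lengthProduct ℓ y z) - 2 * δ ≤ lengthProduct ℓ x z

namespace IsHyperbolicLength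

variable {G : Type*} [Group G] {ℓ : G → ℝ} {δ : ℝ}

lemma nonneg (h : IsHyperbolicLength ℓ δ) (g : G) : 0 ≤ ℓ g := by
  have := h.map_mul_le g g⁻¹
  rw [mul_inv_cancel, h.map_one, h.map_inv] at this
  linarith

lemma map_inv_mul_comm (h : IsHyperbolicLength ℓ δ) (g k : G) : ℓ (g⁻¹ * k) = ℓ (k⁻¹ * g) := by
  rw [← h.map_inv, mul_inv_rev, inv_inv]

lemma map_le_add_inv_mul (h : IsHyperbolicLength ℓ δ) (g k : G) : ℓ g ≤ ℓ k + ℓ (g⁻¹ * k) := by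
  rw [h.map_inv_mul_comm]
  simpa using h.map_mul_le k (k⁻¹ * g)

/-- This is `product_ge` moved to the base point `w` by left invariance; cancelling common terms
turns the minimum of products into a maximum of sums. -/
lemma four_point (h : IsHyperbolicLength ℓ δ) (w x y z : G) :
    ℓ (w⁻¹ * y) + ℓ (x⁻¹ * z) ≤
      max (ℓ (w⁻¹ * x) + ℓ (y⁻¹ * z)) (ℓ (x⁻¹ * y) + ℓ (w⁻¹ * z)) + 2 * δ := by
  have key := h.product_ge (w⁻¹ * x) (w⁻¹ * y) (w⁻¹ * z)
  unfold lengthProduct at key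
  simp only [mul_inv_rev, inv_inv, mul_assoc, mul_inv_cancel_left] at key
  rcases min_choice (ℓ (w⁻¹ * x) + ℓ (w⁻¹ * y) - ℓ (x⁻¹ * y))
    (ℓ (w⁻¹ * y) + ℓ (w⁻¹ * z) - ℓ (y⁻¹ * z)) with h1 | h1 <;> rw [h1] at key
  · have := le_max_right (ℓ (w⁻¹ * x) + ℓ (y⁻¹ * z)) (ℓ (x⁻¹ * y) + ℓ (w⁻¹ * z))
    linarith
  · have := le_max_left (ℓ (w⁻¹ * x) + ℓ (y⁻¹ * z)) (ℓ (x⁻¹ * y) + ℓ (w⁻¹ * z))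
    linarith

lemma map_pow_le (h : IsHyperbolicLength ℓ δ) (g : G) (n : ℕ) : ℓ (g ^ n) ≤ n * ℓ g := by
  induction n with
  | zero => simp [h.map_one]
  | succ n ih =>
    rw [pow_succ]
    have := h.map_mul_le (g ^ n) g
    push_cast
    linarith

lemma lengthProduct_le (h : IsHyperbolicLength ℓ δ) (x y : G) : lengthProduct ℓ x y ≤ 2 * ℓ x := by
  unfold lengthProduct
  have := h.map_le_add_inv_mul y x
  rw [h.map_inv_mul_comm] at this
  linarith

/-! ### Quasi-geodesic powers -/

/-- If `g²` is sufficiently longer than `g`, then the lengths of the powers of `g` grow. -/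
lemma map_pow_add_le_map_pow_succ (h : IsHyperbolicLength ℓ δ) {g : G} {η : ℝ} (hη : 0 < η)
    (hg : ℓ g + 2 * δ + η ≤ ℓ (g ^ 2)) (n : ℕ) : ℓ (g ^ n) + η ≤ ℓ (g ^ (n + 1)) := by
  induction n with
  | zero =>
    have := h.map_pow_le g 2
    have := h.delta_pos
    rw [pow_zero, h.map_one, zero_add, pow_one]
    push_cast at *
    linarith
  | succ n ih =>
    have key := h.four_point 1 g (g ^ 2) (g ^ (n + 2))
    have e1 : g⁻¹ * g ^ (n + 2) = g ^ (n + 1) := by rw [pow_succ' g (n + 1)]; group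
    have e2 : (g ^ 2)⁻¹ * g ^ (n + 2) = g ^ n := by rw [add_comm n, pow_add]; group
    have e3 : g⁻¹ * g ^ 2 = g := by rw [pow_two]; group
    rw [e1, e2, e3, inv_one, one_mul, one_mul, one_mul] at key
    -- The first alternative would contradict the growth from `g ^ n` to `g ^ (n + 1)`.
    rcases max_choice (ℓ g + ℓ (g ^ n)) (ℓ g + ℓ (g ^ (n + 2))) with h1 | h1 <;> rw [h1] at key
    · linarith
    · linarith

/-- If `g²` is sufficiently longer than `g`, then `1` lies near the geodesics from `g⁻ᵖ` to `gˢ`. -/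
lemma map_pow_add_map_pow_le (h : IsHyperbolicLength ℓ δ) {g : G}
    (hg : ℓ g + 3 * δ + 1 ≤ ℓ (g ^ 2)) (p s : ℕ) :
    ℓ (g ^ p) + ℓ (g ^ s) ≤ ℓ (g ^ (p + s)) + (2 * ℓ g + 2 * δ) := by
  have hδ := h.delta_pos
  -- With `η = δ + 1` the two gains, at `p` and at `s`, together exceed the error `2 * δ` and
  -- exclude the first alternative below.
  have mono := h.map_pow_add_le_map_pow_succ (g := g) (η := δ + 1) (by linarith) (by linarith)
  have key := h.four_point 1 (g ^ p) (g ^ (p + 1)) (g ^ (p + 1 + s))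
  have e1 : (g ^ p)⁻¹ * g ^ (p + 1) = g := by rw [pow_succ]; group
  have e2 : (g ^ p)⁻¹ * g ^ (p + 1 + s) = g ^ (s + 1) := by
    rw [add_assoc, pow_add, add_comm 1]; group
  have e3 : (g ^ (p + 1))⁻¹ * g ^ (p + 1 + s) = g ^ s := by rw [pow_add _ (p + 1)]; group
  rw [e1, e2, e3, inv_one, one_mul, one_mul, one_mul] at key
  have hp := mono p
  have hs := mono s
  have hps : ℓ (g ^ (p + 1 + s)) ≤ ℓ (g ^ (p + s)) + ℓ g := by
    rw [add_right_comm, pow_succ]; exact h.map_mul_le _ _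
  rcases max_choice (ℓ (g ^ p) + ℓ (g ^ s)) (ℓ g + ℓ (g ^ (p + 1 + s))) with h1 | h1 <;>
    rw [h1] at key
  · linarith
  · linarith

/-- Otherwise every squaring adds at most `|D|` to twice... the length only up to that error, so `ℓ
(g ^ 2 ^ k)` grows linearly in `k`, against the lower bound `r * 2 ^ k`. -/
lemma exists_pow_sq_length_ge (h : IsHyperbolicLength ℓ δ) {g : G} {r : ℝ} (hr : 0 < r)
    (hg : ∀ n : ℕ, r * n ≤ ℓ (g ^ n)) (D : ℝ) :
    ∃ M : ℕ, 0 < M ∧ ℓ (g ^ M) + D ≤ ℓ ((g ^ M) ^ 2) := by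
  by_contra! hcon
  have bound : ∀ k : ℕ, ℓ (g ^ 2 ^ k) ≤ ℓ g + k * |D| := by
    intro k
    induction k with
    | zero => simp
    | succ k ih =>
      have := hcon (2 ^ k) (by positivity)
      rw [← pow_mul, ← pow_succ] at this
      have := le_abs_self D
      push_cast
      linarith
  obtain ⟨j, hj⟩ := exists_nat_gt ((ℓ g + 2 * |D|) / r)
  rw [div_lt_iff₀ hr] at hj
  have h1 := bound (2 * j)
  have h2 := hg (2 ^ (2 * j))
  have h3 : ((j : ℝ) + 1) ≤ 2 ^ j := by exact_mod_cast Nat.lt_two_pow_self (n := j)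
  have h4 : ((j : ℝ) + 1) * (j + 1) ≤ 2 ^ (2 * j) := by
    rw [two_mul, pow_add]
    exact mul_le_mul h3 h3 (by positivity) (by positivity)
  have h5 : r * (((j : ℝ) + 1) * (j + 1)) ≤ ℓ g + 2 * j * |D| := by
    refine (mul_le_mul_of_nonneg_left h4 hr.le).trans ?_
    push_cast at h1 h2
    exact h2.trans h1
  have h6 := h.nonneg g
  have h7 := abs_nonneg D
  have h8 : (ℓ g + 2 * |D|) * (j + 1) ≤ (j * r) * (j + 1) :=
    mul_le_mul_of_nonneg_right hj.le (by positivity)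
  have h9 : 0 ≤ ℓ g * j := by positivity
  nlinarith [mul_pos hr (by positivity : (0 : ℝ) < (j : ℝ) + 1)]

/-! ### Centralizers of quasi-geodesic cyclic groups -/

/-- An element commuting with a quasi-geodesic cyclic group moves `1` close to that group. -/
lemma exists_mul_zpow_length_le (h : IsHyperbolicLength ℓ δ) {b : G} {r K : ℝ} (hr : 0 < r)
    (hb : ∀ n : ℕ, r * n ≤ ℓ (b ^ n))
    (hK : ∀ p s : ℕ, ℓ (b ^ p) + ℓ (b ^ s) ≤ ℓ (b ^ (p + s)) + K)
    {g : G} (hg : Commute g b) : ∃ i : ℤ, ℓ (g * b ^ i) ≤ K + 4 * δ + ℓ b := by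
  have hδ := h.delta_pos
  -- `N` is so large that `ℓ (b ^ N)` outweighs the constants, which excludes one alternative in
  -- each of `s1` and `s2`; thus `1` is near the geodesic from `g * u` to `g * v`.
  obtain ⟨N, hN⟩ := exists_nat_gt ((2 * ℓ g + 4 * δ + |K|) / r)
  rw [div_lt_iff₀ hr, mul_comm] at hN
  have hfN := hb N
  have hKabs := le_abs_self K
  have hK0 := abs_nonneg K
  have hℓg := h.nonneg g
  set f : ℕ → ℝ := fun n => ℓ (b ^ n) with hf
  set u : G := (b ^ N)⁻¹ with hu
  set v : G := b ^ N with hv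
  have hguv : Commute g v := hg.pow_right N
  have huv : u⁻¹ * v = b ^ (N + N) := by rw [hu, hv, inv_inv, pow_add]
  have hℓu : ℓ u = ℓ v := h.map_inv v
  have hNN : 2 * ℓ v ≤ ℓ (b ^ (N + N)) + K := by have := hK N N; linarith
  have hgu : u⁻¹ * (g * u) = g := by
    rw [hu, inv_inv, ← mul_assoc, ← hguv.eq, mul_inv_cancel_right]
  have hgv : v⁻¹ * (g * v) = g := by rw [hguv.eq, inv_mul_cancel_left]
  have hguv' : (g * u)⁻¹ * (g * v) = b ^ (N + N) := by
    rw [← huv]; group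
  have bu := h.map_le_add_inv_mul u (g * u)
  have bv := h.map_le_add_inv_mul v (g * v)
  rw [hgu] at bu
  rw [hgv] at bv
  have s1 : ℓ (g * u) + ℓ v ≤ ℓ ((g * u)⁻¹ * v) + K + 2 * δ := by
    have key := h.four_point 1 u (g * u) v
    rw [hgu, huv, inv_one, one_mul, one_mul, one_mul] at key
    rcases max_choice (ℓ u + ℓ ((g * u)⁻¹ * v)) (ℓ g + ℓ v) with h1 | h1 <;> rw [h1] at key
    · linarith
    · linarith
  have s2 : ℓ (g * v) + ℓ (g * u) ≤ ℓ (b ^ (N + N)) + K + 4 * δ := by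
    have key := h.four_point 1 v (g * v) (g * u)
    rw [hgv, h.map_inv_mul_comm (g * v), hguv', h.map_inv_mul_comm v, inv_one, one_mul, one_mul,
      one_mul] at key
    rcases max_choice (ℓ v + ℓ (b ^ (N + N))) (ℓ g + ℓ (g * u)) with h1 | h1 <;> rw [h1] at key
    · linarith
    · linarith
  have hb1 : ∀ n : ℕ, |ℓ (b ^ (n + 1)) - ℓ (b ^ n)| ≤ ℓ b := by
    intro n
    rw [abs_le]
    have e1 := h.map_mul_le (b ^ n) b
    have e2 := h.map_mul_le (b ^ (n + 1)) b⁻¹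
    rw [pow_succ, mul_inv_cancel_right, h.map_inv] at e2
    rw [pow_succ]
    constructor <;> linarith
  have hφ0 : 0 ≤ ℓ (g * u) + f (N + N - 0) - ℓ (g * v) - f 0 := by
    have := h.map_mul_le (g * u) (u⁻¹ * v)
    rw [huv, ← huv, mul_assoc, mul_inv_cancel_left, huv] at this
    simp only [hf, pow_zero, h.map_one, Nat.sub_zero]
    linarith
  have hφN : ℓ (g * u) + f (N + N - (N + N)) - ℓ (g * v) - f (N + N) ≤ 0 := by
    have := h.map_mul_le (g * v) (v⁻¹ * u)
    rw [mul_assoc, mul_inv_cancel_left, h.map_inv_mul_comm, huv] at this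
    simp only [hf, pow_zero, h.map_one, Nat.sub_self]
    linarith
  -- This `j` nearly balances the two terms of the maximum in the last use of `four_point`. Each is
  -- then at most half their sum plus `ℓ b`, and `s2` and `hK` bound the sum.
  obtain ⟨j, hj, hj'⟩ := exists_abs_le_of_step
    (φ := fun j => ℓ (g * u) + f (N + N - j) - ℓ (g * v) - f j) (B := 2 * ℓ b) (n := N + N)
    (by linarith [h.nonneg b]) hφ0 hφN (by
      intro i hi
      have e1 := abs_le.1 (hb1 i)
      have e2 := abs_le.1 (hb1 (N + N - (i + 1)))
      rw [show N + N - (i + 1) + 1 = N + N - i by omega] at e2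
      simp only [hf]
      linarith [e1.1, e1.2, e2.1, e2.2])
  refine ⟨(j : ℤ) - N, ?_⟩
  have hw : g * b ^ ((j : ℤ) - N) = g * u * b ^ j := by
    rw [sub_eq_neg_add, zpow_add, zpow_neg, zpow_natCast, zpow_natCast, mul_assoc]
  rw [hw]
  have key := h.four_point 1 (g * u) (g * u * b ^ j) (g * v)
  have e1 : (g * u)⁻¹ * (g * u * b ^ j) = b ^ j := by group
  have e2 : (g * u * b ^ j)⁻¹ * (g * v) = b ^ (N + N - j) := by
    rw [mul_inv_rev, mul_assoc, hguv', inv_mul_eq_iff_eq_mul, ← pow_add]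
    congr 1
    omega
  rw [hguv', e1, e2, inv_one, one_mul, one_mul, one_mul] at key
  have hsum := hK j (N + N - j)
  rw [show j + (N + N - j) = N + N by omega] at hsum
  have habs := abs_le.1 hj'
  simp only [hf] at habs
  rcases max_choice (ℓ (g * u) + ℓ (b ^ (N + N - j))) (ℓ (b ^ j) + ℓ (g * v)) with h1 | h1 <;>
    rw [h1] at key
  · linarith [habs.2]
  · linarith [habs.1]

/-- Each power of `c` can be brought into one fixed finite ball by a power of `b`, so two of the
results coincide. -/
lemma exists_pow_eq_zpow_of_commute (h : IsHyperbolicLength ℓ δ)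
    (hfin : ∀ R : ℝ, {g : G | ℓ g ≤ R}.Finite) {b c : G} {r K : ℝ} (hr : 0 < r)
    (hb : ∀ n : ℕ, r * n ≤ ℓ (b ^ n))
    (hK : ∀ p s : ℕ, ℓ (b ^ p) + ℓ (b ^ s) ≤ ℓ (b ^ (p + s)) + K)
    (hc : Commute c b) : ∃ k : ℕ, 0 < k ∧ ∃ m : ℤ, c ^ k = b ^ m := by
  choose i hi using fun k : ℕ => h.exists_mul_zpow_length_le hr hb hK (hc.pow_left k)
  obtain ⟨k, l, hkl, heq⟩ := (hfin _).exists_lt_map_eq_of_forall_mem hi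
  refine ⟨l - k, by omega, i k - i l, ?_⟩
  have hl : c ^ l = c ^ k * c ^ (l - k) := by rw [← pow_add, Nat.add_sub_cancel' hkl.le]
  rw [hl, mul_assoc, mul_left_cancel_iff] at heq
  rw [zpow_sub, heq, mul_inv_cancel_right]

/-! ### Divergence of the two rays -/

/-- If the products `(bⁿ | c bⁿ)` are unbounded, then the conjugates `b⁻ⁱ c bⁱ` are bounded. -/
lemma conj_pow_length_le (h : IsHyperbolicLength ℓ δ) {b c : G} {K : ℝ}
    (hK : ∀ p s : ℕ, ℓ (b ^ p) + ℓ (b ^ s) ≤ ℓ (b ^ (p + s)) + K)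
    (hunb : ∀ R : ℝ, ∃ n : ℕ, R < lengthProduct ℓ (b ^ n) (c * b ^ n)) (i : ℕ) :
    ℓ ((b ^ i)⁻¹ * (c * b ^ i)) ≤ K + 3 * ℓ c + 4 * δ := by
  have hδ := h.delta_pos
  have hcn := h.nonneg c
  -- This threshold forces `i ≤ n` and makes the product at `n` at least `2 * ℓ (b ^ i)`. The chain
  -- `bⁱ, bⁿ, c bⁿ, c bⁱ` then has large consecutive products.
  obtain ⟨n, hn⟩ := hunb (2 * (i * ℓ b))
  have hin : i ≤ n := by
    by_contra! hlt
    have h1 := h.lengthProduct_le (b ^ n) (c * b ^ n)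
    have h2 := h.map_pow_le b n
    have h3 : (n : ℝ) * ℓ b ≤ i * ℓ b :=
      mul_le_mul_of_nonneg_right (by exact_mod_cast hlt.le) (h.nonneg b)
    linarith
  have hi := h.map_pow_le b i
  have e0 : (b ^ i)⁻¹ * b ^ n = b ^ (n - i) := by
    rw [inv_mul_eq_iff_eq_mul, ← pow_add]; congr 1; omega
  have e1 : (c * b ^ n)⁻¹ * (c * b ^ i) = (b ^ n)⁻¹ * b ^ i := by group
  have hKi := hK i (n - i)
  rw [Nat.add_sub_cancel' hin] at hKi
  have lower : ∀ m : ℕ, ℓ (b ^ m) - ℓ c ≤ ℓ (c * b ^ m) := by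
    intro m
    have := h.map_mul_le c⁻¹ (c * b ^ m)
    rw [inv_mul_cancel_left, h.map_inv] at this
    linarith
  have p1 : 2 * ℓ (b ^ i) - K ≤ lengthProduct ℓ (b ^ i) (b ^ n) := by
    unfold lengthProduct
    rw [e0]
    linarith
  have p3 : 2 * ℓ (b ^ i) - K - 2 * ℓ c ≤ lengthProduct ℓ (c * b ^ n) (c * b ^ i) := by
    unfold lengthProduct
    rw [e1, h.map_inv_mul_comm, e0]
    linarith [lower n, lower i]
  have hK0 : 0 ≤ K := by have := hK 0 0; simp [h.map_one] at this; linarith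
  have q1 : 2 * ℓ (b ^ i) - K - 2 * δ ≤ lengthProduct ℓ (b ^ i) (c * b ^ n) :=
    (sub_le_sub_right (le_min p1 (by linarith)) _).trans (h.product_ge _ (b ^ n) _)
  have q2 : 2 * ℓ (b ^ i) - K - 2 * ℓ c - 2 * δ - 2 * δ ≤ lengthProduct ℓ (b ^ i) (c * b ^ i) :=
    (sub_le_sub_right (le_min (by linarith) (by linarith)) _).trans (h.product_ge _ (c * b ^ n) _)
  unfold lengthProduct at q2
  linarith [h.map_mul_le c (b ^ i)]

/-- Otherwise the conjugates `b⁻ⁱ c bⁱ` are bounded; two of them agree, so `c` commutes with a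
positive power of `b`, and a positive power of `c` is a power of `b`. -/
lemma exists_lengthProduct_pow_le (h : IsHyperbolicLength ℓ δ)
    (hfin : ∀ R : ℝ, {g : G | ℓ g ≤ R}.Finite) {b c : G} {r K : ℝ} (hr : 0 < r)
    (hb : ∀ n : ℕ, r * n ≤ ℓ (b ^ n))
    (hK : ∀ p s : ℕ, ℓ (b ^ p) + ℓ (b ^ s) ≤ ℓ (b ^ (p + s)) + K)
    (hc : ∀ k : ℕ, 0 < k → ∀ m : ℤ, c ^ k ≠ b ^ m) :
    ∃ R : ℝ, ∀ n : ℕ, lengthProduct ℓ (b ^ n) (c * b ^ n) ≤ R := by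
  by_contra! hunb
  obtain ⟨i, j, hij, heq⟩ :=
    (hfin _).exists_lt_map_eq_of_forall_mem (h.conj_pow_length_le hK hunb)
  have hm : 0 < j - i := by omega
  have hcomm : Commute c (b ^ (j - i)) := by
    have hj : b ^ j = b ^ i * b ^ (j - i) := by rw [← pow_add]; congr 1; omega
    rw [hj] at heq
    have : c = (b ^ (j - i))⁻¹ * (c * b ^ (j - i)) := by
      have h1 : b ^ i * b ^ (j - i) = b ^ (j - i) * b ^ i := by rw [← pow_add, ← pow_add, add_comm]
      rw [h1] at heq
      have h2 := congrArg (fun x => b ^ i * x * (b ^ i)⁻¹) heq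
      calc c = b ^ i * ((b ^ i)⁻¹ * (c * b ^ i)) * (b ^ i)⁻¹ := by group
        _ = _ := h2
        _ = _ := by group
    exact (inv_mul_eq_iff_eq_mul.1 this.symm)
  obtain ⟨k, hk, m, hkm⟩ := h.exists_pow_eq_zpow_of_commute hfin (b := b ^ (j - i)) (K := K) hr
    (fun n => by
      rw [← pow_mul]
      refine le_trans ?_ (hb _)
      refine mul_le_mul_of_nonneg_left ?_ hr.le
      exact_mod_cast Nat.le_mul_of_pos_left n hm)
    (fun p s => by
      rw [← pow_mul, ← pow_mul, ← pow_mul, mul_add]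
      exact hK _ _) hcomm
  refine hc k hk (((j - i : ℕ) : ℤ) * m) ?_
  rw [hkm, zpow_mul, zpow_natCast]

/-- If `a` generates an undistorted cyclic subgroup and no positive power of `c` is a power of `a`,
then the rays `(aⁿ)` and `(c aⁿ)` diverge. -/
lemma exists_lengthProduct_pow_le_of_undistorted (h : IsHyperbolicLength ℓ δ)
    (hfin : ∀ R : ℝ, {g : G | ℓ g ≤ R}.Finite) {a c : G} {r : ℝ} (hr : 0 < r)
    (ha : ∀ n : ℕ, r * n ≤ ℓ (a ^ n)) (hc : ∀ k : ℕ, 0 < k → ∀ m : ℤ, c ^ k ≠ a ^ m) :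
    ∃ R : ℝ, ∀ n : ℕ, lengthProduct ℓ (a ^ n) (c * a ^ n) ≤ R := by
  obtain ⟨M, hM, hM2⟩ := h.exists_pow_sq_length_ge hr ha (3 * δ + 1)
  obtain ⟨R, hR⟩ := h.exists_lengthProduct_pow_le hfin (b := a ^ M) (c := c) hr
    (fun n => by
      rw [← pow_mul]
      refine le_trans ?_ (ha _)
      refine mul_le_mul_of_nonneg_left ?_ hr.le
      exact_mod_cast Nat.le_mul_of_pos_left n hM)
    (h.map_pow_add_map_pow_le (by linarith))
    (fun k hk m hkm => hc k hk (M * m) (by rw [hkm, zpow_mul, zpow_natCast]))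
  -- The remainder `t = a ^ (n % M)` has length at most `M * ℓ a` and enters four times: once in
  -- each of the two lengths, twice in the distance.
  refine ⟨R + 4 * (M * ℓ a), fun n => ?_⟩
  have hn : a ^ n = (a ^ M) ^ (n / M) * a ^ (n % M) := by
    rw [← pow_mul, ← pow_add, Nat.div_add_mod]
  have hRn := hR (n / M)
  set B := (a ^ M) ^ (n / M)
  set t := a ^ (n % M)
  have ht : ℓ t ≤ M * ℓ a := by
    refine (h.map_pow_le a _).trans (mul_le_mul_of_nonneg_right ?_ (h.nonneg a))
    exact_mod_cast (Nat.mod_lt n hM).le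
  rw [hn]
  unfold lengthProduct at hRn ⊢
  have h1 := h.map_mul_le B t
  have h2 := h.map_mul_le (c * B) t
  have h3 : ℓ (B⁻¹ * (c * B)) ≤ ℓ t + ℓ ((B * t)⁻¹ * (c * (B * t))) + ℓ t := by
    have e : B⁻¹ * (c * B) = t * ((B * t)⁻¹ * (c * (B * t))) * t⁻¹ := by group
    rw [e]
    have i1 := h.map_mul_le (t * ((B * t)⁻¹ * (c * (B * t)))) t⁻¹
    have i2 := h.map_mul_le t ((B * t)⁻¹ * (c * (B * t)))
    rw [h.map_inv] at i1
    linarith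
  rw [mul_assoc] at h2
  linarith

/-! ### Exponential lower bounds -/

/-- A path whose consecutive points have large products has endpoints whose product is smaller by
at most a logarithmic term. -/
lemma le_lengthProduct_two_pow (h : IsHyperbolicLength ℓ δ) {p : ℕ → G} {B : ℝ}
    (hp : ∀ i, B ≤ lengthProduct ℓ (p i) (p (i + 1))) (k i : ℕ) :
    B - 2 * δ * k ≤ lengthProduct ℓ (p i) (p (i + 2 ^ k)) := by
  induction k generalizing i with
  | zero => simpa using hp i
  | succ k ih =>
    -- Bisecting at the midpoint costs `2 * δ` per level.
    have := h.product_ge (p i) (p (i + 2 ^ k)) (p (i + 2 ^ (k + 1)))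
    have h2 := ih (i + 2 ^ k)
    rw [add_assoc, ← two_mul, ← pow_succ'] at h2
    have h3 := le_min (ih i) h2
    push_cast
    linarith

end IsHyperbolicLength

lemma IsWordHyperbolic.exists_isHyperbolicLength {G : Type*} [Group G] (hG : IsWordHyperbolic G) :
    ∃ S : Finset G, Subgroup.closure (S : Set G) = ⊤ ∧
      ∃ δ : ℝ, IsHyperbolicLength (fun g => (wordDist S 1 g : ℝ)) δ := by
  obtain ⟨S, hS, δ, h⟩ := hG
  refine ⟨S, hS, max δ 1, ?_, ?_, ?_, by positivity, ?_⟩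
  · simp [wordDist]
  · intro g
    have := wordDist_one_inv_mul hS g 1
    rw [mul_one] at this
    rw [this, wordDist_comm]
  · intro g k
    have h1 := (mulCayley_connected hS).dist_triangle (u := 1) (v := g) (w := g * k)
    have h2 := wordDist_one_inv_mul hS g (g * k)
    rw [inv_mul_cancel_left] at h2
    rw [h2]
    exact_mod_cast h1
  · intro x y z
    have key := h 1 x y z
    have hδ := le_max_left δ 1
    simp only [gromovProduct, wordDist_comm S _ 1] at key
    simp only [lengthProduct, wordDist_one_inv_mul hS]
    rcases min_choice (((wordDist S 1 x : ℝ) + wordDist S 1 y - wordDist S x y) / 2)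
      (((wordDist S 1 y : ℝ) + wordDist S 1 z - wordDist S y z) / 2) with h1 | h1 <;> rw [h1] at key
    · have := min_le_left ((wordDist S 1 x : ℝ) + wordDist S 1 y - wordDist S x y)
        ((wordDist S 1 y : ℝ) + wordDist S 1 z - wordDist S y z)
      linarith
    · have := min_le_right ((wordDist S 1 x : ℝ) + wordDist S 1 y - wordDist S x y)
        ((wordDist S 1 y : ℝ) + wordDist S 1 z - wordDist S y z)
      linarith

/-- A sequence bounded below by `2 ^ k / 2`, with `k` growing at least linearly, grows
exponentially. -/
lemma exists_pow_sub_lt {u : ℕ → ℕ} {μ κ : ℝ} (hμ : 0 < μ)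
    (hu : ∀ n, ∃ k : ℕ, 2 ^ k ≤ 2 * u n ∧ μ * n ≤ k + κ) :
    ∃ α β : ℝ, 1 < α ∧ 0 < β ∧ ∀ n : ℕ, α ^ n - β < (u n : ℝ) := by
  -- Half the rate suffices: either `μ / 2 * n ≤ k - 1` and `2 ^ k / 2` dominates `α ^ n`, or `μ / 2
  -- * n < κ + 1` and `β` does.
  refine ⟨2 ^ (μ / 2), 2 ^ (κ + 1), Real.one_lt_rpow (by norm_num) (by positivity), by positivity,
    fun n => ?_⟩
  obtain ⟨k, hk, hn⟩ := hu n
  have hα : ((2 : ℝ) ^ (μ / 2)) ^ n = 2 ^ (μ / 2 * n) := by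
    rw [Real.rpow_mul (by norm_num), Real.rpow_natCast]
  have hβ : (0 : ℝ) < 2 ^ (κ + 1) := by positivity
  rw [hα]
  rcases le_or_gt (μ / 2 * n) (k - 1) with hle | hlt
  · have h1 : (2 : ℝ) ^ (μ / 2 * n) ≤ 2 ^ ((k : ℝ) - 1) :=
      Real.rpow_le_rpow_of_exponent_le (by norm_num) hle
    rw [Real.rpow_sub (by norm_num), Real.rpow_natCast, Real.rpow_one] at h1
    have h2 : (2 : ℝ) ^ k ≤ 2 * u n := by exact_mod_cast hk
    linarith
  · have h1 : (2 : ℝ) ^ (μ / 2 * n) < 2 ^ (κ + 1) :=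
      Real.rpow_lt_rpow_of_exponent_lt (by norm_num) (by linarith)
    have h2 : (0 : ℝ) ≤ u n := Nat.cast_nonneg _
    linarith

end WordMetric

/-! ### The main theorem -/

open WordMetric in
/-- `E : 1 → C → A → Q → 1` is a short exact sequence; `E.conjAct (a ^ n)⁻¹ c` is the element of `C`
that maps to `a⁻ⁿ c aⁿ` in `A`. -/
theorem lemma12 {C A Q : Type*} [Group C] [Group A] [Group Q] (E : GroupExtension C A Q)
    (S : Finset C) (hS : Subgroup.closure (S : Set C) = ⊤)
    (hA : IsWordHyperbolic A)
    (x : Q) (hx : IsUndistorted x)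
    (a : A) (ha : E.rightHom a = x)
    (c : C) (hc : ¬ IsOfFinOrder c) :
    ∃ α β : ℝ, 1 < α ∧ 0 < β ∧
      ∀ n : ℕ, α ^ n - β < (wordDist S 1 (E.conjAct (a ^ n)⁻¹ c) : ℝ) := by
  obtain ⟨U, hU, δ, h⟩ := hA.exists_isHyperbolicLength
  obtain ⟨T, hT, r, hr, hxr⟩ := hx
  obtain ⟨L, hL⟩ := exists_wordDist_map_le hS hU E.inl
  obtain ⟨P, hP⟩ := exists_wordDist_map_le hU hT E.rightHom
  have hδ := h.delta_pos
  have hx_ne : ∀ m : ℤ, x ^ m = 1 → m = 0 := by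
    intro m hm
    have hle := hxr m 0
    rw [hm, zpow_zero, wordDist, SimpleGraph.dist_self, Nat.cast_zero] at hle
    by_contra hm0
    have : 0 < r * |(m : ℝ) - ((0 : ℤ) : ℝ)| := mul_pos hr (abs_pos.2 (by simpa using hm0))
    linarith
  set ℓ : A → ℝ := fun g => (wordDist U 1 g : ℝ) with hℓ
  -- Every element over `x ^ n` is long, since `E.rightHom` is `P`-Lipschitz; `P + 1` avoids a zero
  -- denominator.
  have hℓlow : ∀ (n : ℕ) (g : A), E.rightHom g = x ^ n → r / (P + 1) * n ≤ ℓ g := by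
    intro n g hg
    have h1 := hxr 0 n
    have h2 := hP 1 g
    rw [map_one, hg] at h2
    have h3 : (wordDist T 1 (x ^ n) : ℝ) ≤ P * ℓ g := by
      simp only [hℓ]
      exact_mod_cast h2
    have h4 : 0 ≤ ℓ g := h.nonneg g
    simp only [zpow_zero, zpow_natCast, Int.cast_zero, zero_sub, abs_neg, Int.cast_natCast,
      Nat.abs_cast] at h1
    rw [div_mul_eq_mul_div, div_le_iff₀ (by positivity)]
    linarith
  have hρ : 0 < r / (P + 1) := by positivity
  set ρ := r / (P + 1)
  have hfin : ∀ R : ℝ, {g : A | ℓ g ≤ R}.Finite := by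
    intro R
    refine (finite_setOf_wordDist_le hU ⌊R⌋₊).subset fun g hg => ?_
    exact Nat.le_floor hg
  have hne : ∀ k : ℕ, 0 < k → ∀ m : ℤ, E.inl c ^ k ≠ a ^ m := by
    intro k hk m hkm
    have h1 := congrArg E.rightHom hkm
    rw [map_pow, E.rightHom_inl, one_pow, map_zpow, ha] at h1
    rw [hx_ne m h1.symm, zpow_zero, ← map_pow, map_eq_one_iff _ E.inl_injective] at hkm
    exact hc (isOfFinOrder_iff_pow_eq_one.2 ⟨k, hk, hkm⟩)
  obtain ⟨R, hR⟩ := h.exists_lengthProduct_pow_le_of_undistorted hfin hρ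
    (fun n => hℓlow n (a ^ n) (by rw [map_pow, ha])) hne
  refine exists_pow_sub_lt (μ := ρ / δ) (κ := (L + R) / (2 * δ)) (by positivity) fun n => ?_
  set w := E.conjAct (a ^ n)⁻¹ c with hw
  obtain ⟨p, hp⟩ := (mulCayley_connected hS).exists_walk_length_eq_dist 1 w
  have hw1 : w ≠ 1 := by
    rw [hw, Ne, EmbeddingLike.map_eq_one_iff]
    rintro rfl
    exact hc IsOfFinOrder.one
  have hpos : 0 < wordDist S 1 w := (mulCayley_connected hS).pos_dist_of_ne hw1.symm
  -- This `k` satisfies `2 ^ (k - 1) ≤ wordDist S 1 w < 2 ^ k`; `getVert` stays at the endpoint past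
  -- the end, which pads the path to `2 ^ k` steps.
  refine ⟨Nat.log 2 (wordDist S 1 w) + 1, ?_, ?_⟩
  · rw [pow_succ']
    exact Nat.mul_le_mul_left 2 (Nat.pow_log_le_self 2 hpos.ne')
  set k := Nat.log 2 (wordDist S 1 w) + 1
  have hk : p.length ≤ 2 ^ k := by rw [hp]; exact (Nat.lt_pow_succ_log_self (by norm_num) _).le
  have hstep : ∀ i, 2 * (ρ * n) - L ≤
      lengthProduct ℓ (a ^ n * E.inl (p.getVert i)) (a ^ n * E.inl (p.getVert (i + 1))) := by
    intro i
    have hlow : ∀ j, ρ * n ≤ ℓ (a ^ n * E.inl (p.getVert j)) := fun j =>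
      hℓlow n _ (by rw [map_mul, E.rightHom_inl, mul_one, map_pow, ha])
    have hdist : ℓ ((a ^ n * E.inl (p.getVert i))⁻¹ * (a ^ n * E.inl (p.getVert (i + 1)))) ≤ L := by
      simp only [hℓ]
      rw [wordDist_one_inv_mul hU, wordDist_mul_left hU]
      refine Nat.cast_le.2 ((hL _ _).trans (mul_le_of_le_one_right (Nat.zero_le _) ?_))
      rcases lt_or_ge i p.length with hi | hi
      · exact (SimpleGraph.dist_eq_one_iff_adj.2 (p.adj_getVert_succ hi)).le
      · rw [p.getVert_of_length_le hi, p.getVert_of_length_le (by omega), wordDist,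
          SimpleGraph.dist_self]
        exact zero_le_one
    unfold lengthProduct
    linarith [hlow i, hlow (i + 1)]
  have key := h.le_lengthProduct_two_pow hstep k 0
  rw [zero_add, p.getVert_zero, p.getVert_of_length_le hk, map_one, mul_one, hw,
    E.inl_conjAct_comm] at key
  have hR' := hR n
  rw [show a ^ n * ((a ^ n)⁻¹ * E.inl c * ((a ^ n)⁻¹)⁻¹) = E.inl c * a ^ n by group] at key
  have : ρ / δ * n = (2 * (ρ * n)) / (2 * δ) := by field_simp
  rw [this, ← sub_le_iff_le_add, ← sub_div, div_le_iff₀ (by positivity)]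
  linarith
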